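/- Let $m,n,k$ be positive integers with $1\le k\le \min\{m,n\}$, and let $|v\rangle\in\mathbb{C}^m\otimes\mathbb{C}^n$ be a pure state, i.e. a unit vector. Write its Schmidt decomposition as $|v\rangle=\sum_{i=1}^{\min\{m,n\}}\alpha_i\,|a_i\rangle\otimes|b_i\rangle$ with $\{|a_i\rangle\}\subset\mathbb{C}^m$ and $\{|b_i\rangle\}\subset\mathbb{C}^n$ orthonormal and Schmidt coefficients $\alpha_1\ge\alpha_2\ge\cdots\ge\alpha_{\min\{m,n\}}\ge 0$. The Schmidt rank $SR(|u\rangle)$ of a pure state $|u\rangle$ is the least number of product states $|a\rangle\otimes|b\rangle$ (with $|a\rangle$, $|b\rangle$ unit vectors) of which $|u\rangle$ is a linear combination. For an operator $X$ on $\mathbb{C}^m\otimes\mathbb{C}^n$ define $$\|X\|_{\gamma,k}:=\inf\Big\{\sum_i|c_i| \;:\; X=\sum_i c_i\,|v_i\rangle\langle w_i|,\ c_i\in\mathbb{C},\ |v_i\rangle,|w_i\rangle \text{ unit vectors with } SR(|v_i\rangle),SR(|w_i\rangle)\le k \text{ for all } i\Big\},$$ where the infimum is over all finite decompositions of this form.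 Let $r$ be the largest index $1\le r<k$ such that $$\alpha_r>\frac{1}{k-r}\sum_{i=r+1}^{\min\{m,n\}}\alpha_i,$$ with $r=0$ if no such index exists, and let $\tilde\alpha:=\frac{1}{k-r}\sum_{i=r+1}^{\min\{m,n\}}\alpha_i$. Then $$\big\|\,|v\rangle\langle v|\,\big\|_{\gamma,k}=\sum_{i=1}^{r}\alpha_i^2+(k-r)\,\tilde\alpha^2 .$$ -/

import Mathlib

open scoped TensorProduct InnerProductSpace

namespace EntanglementNorm

noncomputable section

/-- The bipartite Hilbert space `ℂ^m ⊗ ℂ^n` with its natural inner product,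
`⟪a ⊗ b, c ⊗ d⟫ = ⟪a, c⟫ * ⟪b, d⟫`. -/
abbrev Bipartite (m n : ℕ) : Type :=
  EuclideanSpace ℂ (Fin m) ⊗[ℂ] EuclideanSpace ℂ (Fin n)

/-- The operator `|v⟩⟨w|`, that is `z ↦ ⟪w, z⟫ • v`. -/
abbrev ketbra {m n : ℕ} (v w : Bipartite m n) : Bipartite m n →L[ℂ] Bipartite m n :=
  InnerProductSpace.rankOne ℂ v w

/-- A separable pure state: `|a⟩ ⊗ |b⟩` with unit vectors `|a⟩` and `|b⟩`. -/
def IsSeparable {m n : ℕ} (v : Bipartite m n) : Prop :=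
  ∃ (a : EuclideanSpace ℂ (Fin m)) (b : EuclideanSpace ℂ (Fin n)),
    ‖a‖ = 1 ∧ ‖b‖ = 1 ∧ v = a ⊗ₜ[ℂ] b

/-- The Schmidt rank: the least `k` such that `v` is a linear combination of `k` separable
pure states. -/
def schmidtRank {m n : ℕ} (v : Bipartite m n) : ℕ :=
  sInf {k : ℕ | ∃ (c : Fin k → ℂ) (u : Fin k → Bipartite m n),
    (∀ i, IsSeparable (u i)) ∧ v = ∑ i, c i • u i}

/-- The norm `‖X‖_{γ,k}`: the infimum of `∑ i, |c i|` over all finite decompositions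
`X = ∑ i, c i • |v i⟩⟨w i|` into pure states `v i`, `w i` of Schmidt rank at most `k`. -/
def gammaNorm {m n : ℕ} (k : ℕ) (X : Bipartite m n →L[ℂ] Bipartite m n) : ℝ :=
  sInf {s : ℝ | ∃ (N : ℕ) (c : Fin N → ℂ) (v w : Fin N → Bipartite m n),
    (∀ i, ‖v i‖ = 1 ∧ schmidtRank (v i) ≤ k) ∧
    (∀ i, ‖w i‖ = 1 ∧ schmidtRank (w i) ≤ k) ∧
    X = ∑ i, c i • ketbra (v i) (w i) ∧
    s = ∑ i, ‖c i‖}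

/-- `α 1 ≥ α 2 ≥ ⋯ ≥ α (min m n) ≥ 0` are the Schmidt coefficients of `v`, padded with zeros up
to the index `min m n`. The values of `α` at other indices are irrelevant. -/
def IsSchmidtCoefficients {m n : ℕ} (v : Bipartite m n) (α : ℕ → ℝ) : Prop :=
  AntitoneOn α (Set.Icc 1 (min m n)) ∧
  (∀ i ∈ Set.Icc 1 (min m n), 0 ≤ α i) ∧
  ∃ (a : Fin (min m n) → EuclideanSpace ℂ (Fin m))
    (b : Fin (min m n) → EuclideanSpace ℂ (Fin n)),
    Orthonormal ℂ a ∧ Orthonormal ℂ b ∧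
    v = ∑ i : Fin (min m n), (α (i.val + 1) : ℂ) • (a i ⊗ₜ[ℂ] b i)

/-- The quantity `(∑_{i = r + 1}^{d} α i) / (k - r)`. -/
def tailMean (d k : ℕ) (α : ℕ → ℝ) (r : ℕ) : ℝ :=
  (∑ i ∈ Finset.Icc (r + 1) d, α i) / ((k : ℝ) - (r : ℝ))

/-- The largest index `1 ≤ r < k` with `α r > (∑_{i = r + 1}^{d} α i) / (k - r)`, and `0` if there
is no such index (the supremum of the empty set of natural numbers is `0`). -/
def cutIndex (d k : ℕ) (α : ℕ → ℝ) : ℕ :=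
  sSup {r : ℕ | 1 ≤ r ∧ r < k ∧ tailMean d k α r < α r}

end

/-- Every vector has a Schmidt decomposition. -/
theorem exists_isSchmidtCoefficients {m n : ℕ} (v : Bipartite m n) :
    ∃ α : ℕ → ℝ, IsSchmidtCoefficients v α := by
  classical
  let e := EuclideanSpace.basisFun (Fin n) ℂ
  obtain ⟨x, hx⟩ : ∃ x : Fin n → EuclideanSpace ℂ (Fin m), v = ∑ j, x j ⊗ₜ[ℂ] e j := by
    induction v using TensorProduct.induction_on with
    | zero => exact ⟨0, by simp⟩
    | tmul a b =>
      refine ⟨fun j => ⟪e j, b⟫_ℂ • a, ?_⟩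
      simp_rw [TensorProduct.smul_tmul, ← TensorProduct.tmul_sum]
      rw [e.sum_repr' b]
    | add y z hy hz =>
      obtain ⟨x, rfl⟩ := hy
      obtain ⟨x', rfl⟩ := hz
      exact ⟨x + x', by simp [TensorProduct.add_tmul, Finset.sum_add_distrib]⟩
  let T : EuclideanSpace ℂ (Fin n) →ₗ[ℂ] EuclideanSpace ℂ (Fin m) := e.toBasis.constr ℂ x
  have hT : ∀ j, T (e j) = x j := fun j => by
    have h := e.toBasis.constr_basis ℂ x j
    rwa [e.coe_toBasis] at h
  have hn : Module.finrank ℂ (EuclideanSpace ℂ (Fin n)) = n := by simp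
  let f := T.isSymmetric_adjoint_comp_self.eigenvectorBasis hn
  have hTf : ∀ i j, ⟪T (f i), T (f j)⟫_ℂ = if i = j then ((T.singularValues j : ℝ) : ℂ) ^ 2 else 0 := by
    intro i j
    rw [← LinearMap.adjoint_inner_right, ← LinearMap.comp_apply,
      T.isSymmetric_adjoint_comp_self.apply_eigenvectorBasis hn j, inner_smul_right,
      ← T.sq_singularValues_fin hn j]
    change _ * ⟪f i, f j⟫_ℂ = _
    rw [f.inner_eq_ite]
    split_ifs <;> simp
  let g : Fin n → EuclideanSpace ℂ (Fin n) := fun l => ∑ j, ⟪f l, e j⟫_ℂ • e j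
  have hg : Orthonormal ℂ g := by
    rw [orthonormal_iff_ite]
    intro i j
    have h : ⟪g i, g j⟫_ℂ = ⟪f j, f i⟫_ℂ := by
      rw [← e.sum_inner_mul_inner (f j) (f i), e.orthonormal.inner_sum]
      refine Finset.sum_congr rfl fun l _ => ?_
      rw [inner_conj_symm, mul_comm]
    rw [h, f.inner_eq_ite]
    simp [eq_comm]
  have hv : v = ∑ l, T (f l) ⊗ₜ[ℂ] g l := by
    rw [hx]
    have h1 : ∀ j, x j = ∑ l, ⟪f l, e j⟫_ℂ • T (f l) := fun j => by
      rw [← hT j]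
      conv_lhs => rw [← f.sum_repr' (e j)]
      simp
    simp_rw [h1, TensorProduct.sum_tmul, g, TensorProduct.tmul_sum, TensorProduct.smul_tmul]
    exact Finset.sum_comm
  have hσ0 : ∀ i, n ≤ i → T.singularValues i = 0 := fun i hi =>
    T.singularValues_of_finrank_le (by simpa using hi)
  have hσm : ∀ i, m ≤ i → T.singularValues i = 0 := fun i hi => by
    rw [← Finsupp.notMem_support_iff, T.support_singularValues]
    have : Module.finrank ℂ (LinearMap.range T) ≤ m := by
      simpa using Submodule.finrank_le (LinearMap.range T)
    simp
    omega
  let a' : Fin m → EuclideanSpace ℂ (Fin m) := fun i =>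
    if h : i.val < n then ((T.singularValues i : ℝ) : ℂ)⁻¹ • T (f ⟨i, h⟩) else 0
  let s : Set (Fin m) := {i | T.singularValues i ≠ 0}
  have hs : ∀ i ∈ s, i.val < n := fun i hi => by
    by_contra h
    exact hi (hσ0 i (by omega))
  have ha' : Orthonormal ℂ (s.domRestrict a') := by
    rw [orthonormal_iff_ite]
    rintro ⟨i, hi⟩ ⟨j, hj⟩
    have hi0 : ((T.singularValues i : ℝ) : ℂ) ≠ 0 := by exact_mod_cast hi
    have hj0 : ((T.singularValues j : ℝ) : ℂ) ≠ 0 := by exact_mod_cast hj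
    simp only [Set.domRestrict_apply, a', hs i hi, hs j hj, dif_pos, inner_smul_left,
      inner_smul_right, hTf, Subtype.mk.injEq, Fin.ext_iff]
    split_ifs with h
    · have : i = j := Fin.ext h
      subst this
      simp
      field_simp
    · simp
  obtain ⟨A, hA⟩ := ha'.exists_orthonormalBasis_extension_of_card_eq (by simp)
  have hTA : ∀ (j : ℕ) (h1 : j < n) (h2 : j < m),
      T (f ⟨j, h1⟩) = ((T.singularValues j : ℝ) : ℂ) • A ⟨j, h2⟩ := by
    intro j h1 h2
    by_cases h : T.singularValues j = 0
    · have h3 := hTf ⟨j, h1⟩ ⟨j, h1⟩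
      simp [h] at h3
      simp [h, h3]
    · rw [hA ⟨j, h2⟩ h]
      simp [a', h1, smul_smul, h]
  have hT0 : ∀ j : Fin n, m ≤ j.val → T (f j) = 0 := by
    intro j hj
    have h3 := hTf j j
    simpa [hσm j hj] using h3
  refine ⟨fun i => T.singularValues (i - 1), ?_, fun i _ => T.singularValues_nonneg _,
    fun i => A (Fin.castLE (min_le_left m n) i), fun i => g (Fin.castLE (min_le_right m n) i),
    A.orthonormal.comp _ (Fin.castLE_injective _), hg.comp _ (Fin.castLE_injective _), ?_⟩
  · intro i _ j _ hij
    exact T.singularValues_antitone (Nat.sub_le_sub_right hij 1)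
  · rw [hv]
    symm
    refine Finset.sum_of_injOn (Fin.castLE (min_le_right m n))
      (Fin.castLE_injective _).injOn (by simp) ?_ ?_
    · intro j _ hj
      rw [hT0 j, TensorProduct.zero_tmul]
      by_contra h
      exact hj ⟨⟨j, by omega⟩, by simp, rfl⟩
    · intro i _
      have := hTA i (by omega) (by omega)
      rw [show Fin.castLE (min_le_right m n) i = ⟨i, by omega⟩ from rfl, this,
        TensorProduct.smul_tmul']
      simp
      rfl

/-- The infimum that defines the Schmidt rank is attained. -/
theorem schmidtRank_spec {m n : ℕ} (v : Bipartite m n) :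
    ∃ (c : Fin (schmidtRank v) → ℂ) (u : Fin (schmidtRank v) → Bipartite m n),
      (∀ i, IsSeparable (u i)) ∧ v = ∑ i, c i • u i := by
  obtain ⟨α, -, -, a, b, ha, hb, h⟩ := exists_isSchmidtCoefficients v
  exact Nat.sInf_mem (s := {k : ℕ | ∃ (c : Fin k → ℂ) (u : Fin k → Bipartite m n),
    (∀ i, IsSeparable (u i)) ∧ v = ∑ i, c i • u i})
    ⟨min m n, fun i => (α (i.val + 1) : ℂ), fun i => a i ⊗ₜ[ℂ] b i,
      fun i => ⟨a i, b i, ha.1 i, hb.1 i, rfl⟩, h⟩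

end EntanglementNorm

/-!
Let `w = ∑ i, β i • a i ⊗ b i`, where `β i = α i` for `i ≤ r` and `β i = α̃` for `i > r`, and let
`p i = α i / β i`. The choice of `r` makes `p` a point of `[0, 1]^d` with `∑ i, p i ≤ k` that
maximizes the linear functional `∑ i, β i ^ 2 * q i` over all such points `q`; the maximum `M` is
the asserted value.

By Birkhoff's theorem `p` is a convex combination of indicators of sets of size at most `k`, so `v`
is a convex combination of truncations of `w`. These have Schmidt rank at most `k` and squared norm
at most `M`, and expanding `|v⟩⟨v|` gives a decomposition of cost at most `M`.

For the lower bound, pair decompositions with `|w⟩⟨w|`. A unit vector of Schmidt rank at most `k`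
lies in `V ⊗ ℂ^n` with `dim V ≤ k`, so its squared overlap with `w` is at most
`∑ i, β i ^ 2 * ‖P_V (a i)‖ ^ 2 ≤ M`, while `⟪w, v⟫ = M`. Hence every decomposition costs at least
`M`.
-/

namespace EntanglementNorm

open Finset

section CappedSimplex

variable {ι : Type*} [Fintype ι] {k : ℕ}

/-- The capped simplex `{p ∈ [0, 1]^ι | ∑ i, p i ≤ k}`, the polytope of fractional `k`-subsets of
`ι`. -/
def cappedSimplex (ι : Type*) [Fintype ι] (k : ℕ) : Set (ι → ℝ) :=
  {p | (∀ i, 0 ≤ p i) ∧ (∀ i, p i ≤ 1) ∧ ∑ i, p i ≤ k}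

theorem indicator_one_mem_cappedSimplex {S : Finset ι} (hS : #S ≤ k) :
    (S : Set ι).indicator 1 ∈ cappedSimplex ι k := by
  classical
  refine ⟨fun i => Set.indicator_nonneg (fun _ _ => zero_le_one) i,
    fun i => Set.indicator_le_self' (fun _ _ => zero_le_one) i, ?_⟩
  simpa [Set.indicator_apply] using hS

/-- The matrix `[[1 - diag p, p / k], [pᵀ / k, 1 - (∑ i, p i) / k]]`, a doubly stochastic dilation
of `p` to which Birkhoff's theorem applies: its upper right block has row sums `p`. -/
noncomputable def cappedSimplexDilation [DecidableEq ι] (k : ℕ) (p : ι → ℝ) :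
    Matrix (ι ⊕ Fin k) (ι ⊕ Fin k) ℝ :=
  Matrix.fromBlocks (Matrix.diagonal fun i => 1 - p i) (Matrix.of fun i _ => p i / k)
    (Matrix.of fun _ i => p i / k) (Matrix.diagonal fun _ => 1 - (∑ i, p i) / k)

theorem sum_div_eq_of_mem_cappedSimplex {p : ι → ℝ} (hp : p ∈ cappedSimplex ι k) (i : ι) :
    ∑ _l : Fin k, p i / k = p i := by
  obtain ⟨hp0, -, hpk⟩ := hp
  have hle : p i ≤ k := (single_le_sum (fun j _ => hp0 j) (mem_univ i)).trans hpk
  rw [sum_const, card_univ, Fintype.card_fin, nsmul_eq_mul]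
  exact mul_div_cancel_of_imp' fun hk => le_antisymm (hk ▸ hle) (hp0 i)

theorem cappedSimplexDilation_mem_doublyStochastic [DecidableEq ι] {p : ι → ℝ}
    (hp : p ∈ cappedSimplex ι k) : cappedSimplexDilation k p ∈ doublyStochastic ℝ (ι ⊕ Fin k) := by
  have hrow : ∀ x, ∑ y, cappedSimplexDilation k p x y = 1 := by
    rintro (i | l) <;> rw [Fintype.sum_sum_type]
    · have hblock := sum_div_eq_of_mem_cappedSimplex hp i
      simp [cappedSimplexDilation, Matrix.diagonal_apply, -sum_const, hblock]
    · simp [cappedSimplexDilation, Matrix.diagonal_apply, ← sum_div]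
  have hsymm : (cappedSimplexDilation k p).IsSymm :=
    (Matrix.isSymm_diagonal _).fromBlocks rfl (Matrix.isSymm_diagonal _)
  refine mem_doublyStochastic_iff_sum.2 ⟨?_, hrow, fun y => by
    simpa only [hsymm.apply] using hrow y⟩
  obtain ⟨hp0, hp1, hpk⟩ := hp
  have hpk' : (∑ i, p i) / k ≤ 1 := div_le_one_of_le₀ hpk k.cast_nonneg
  rintro (i | l) (j | l') <;>
    simp only [cappedSimplexDilation, Matrix.fromBlocks_apply₁₁, Matrix.fromBlocks_apply₁₂,
      Matrix.fromBlocks_apply₂₁, Matrix.fromBlocks_apply₂₂, Matrix.diagonal_apply, Matrix.of_apply]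
  · split_ifs <;> simp [hp1 i]
  · exact div_nonneg (hp0 i) k.cast_nonneg
  · exact div_nonneg (hp0 j) k.cast_nonneg
  · split_ifs <;> simp [hpk']

theorem cappedSimplex_subset_convexHull :
    cappedSimplex ι k ⊆
      convexHull ℝ ((fun S : Finset ι => (S : Set ι).indicator 1) '' {S | #S ≤ k}) := by
  classical
  intro p hp
  let blockSum : Matrix (ι ⊕ Fin k) (ι ⊕ Fin k) ℝ →ₗ[ℝ] ι → ℝ :=
    { toFun M i := ∑ l, M (.inl i) (.inr l)
      map_add' M N := by ext; simp [sum_add_distrib]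
      map_smul' c M := by ext; simp [mul_sum] }
  have hp_eq : blockSum (cappedSimplexDilation k p) = p :=
    funext (sum_div_eq_of_mem_cappedSimplex hp)
  have hM := cappedSimplexDilation_mem_doublyStochastic hp
  rw [← SetLike.mem_coe, doublyStochastic_eq_convexHull_permMatrix] at hM
  rw [← hp_eq]
  refine (blockSum.image_convexHull _).subset.trans (convexHull_mono ?_) ⟨_, hM, rfl⟩
  rintro _ ⟨_, ⟨σ, rfl⟩, rfl⟩
  refine ⟨({i | (σ (.inl i)).isRight} : Finset ι), ?_, ?_⟩
  · calc #{i : ι | (σ (.inl i)).isRight} ≤ #((univ : Finset (Fin k)).map .inr) := by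
          refine card_le_card_of_injOn (fun i => σ (.inl i)) (fun i hi => ?_)
            (σ.injective.comp Sum.inl_injective).injOn
          obtain ⟨l, hl⟩ := Sum.isRight_iff.1 (mem_filter.1 (mem_coe.1 hi)).2
          simp [hl]
      _ = k := by simp
  · ext i
    rcases h : σ (.inl i) <;> simp [blockSum, Equiv.Perm.permMatrix, PEquiv.toMatrix_apply, h]

theorem cappedSimplex_mono {l : ℕ} (h : k ≤ l) : cappedSimplex ι k ⊆ cappedSimplex ι l :=
  fun _ hp => ⟨hp.1, hp.2.1, hp.2.2.trans (mod_cast h)⟩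

theorem exists_sum_smul_indicator_eq_of_mem_cappedSimplex {p : ι → ℝ}
    (hp : p ∈ cappedSimplex ι k) :
    ∃ (κ : Type) (_ : Fintype κ) (w : κ → ℝ) (S : κ → Finset ι), (∀ j, 0 ≤ w j) ∧
      ∑ j, w j = 1 ∧ (∀ j, #(S j) ≤ k) ∧ p = ∑ j, w j • (S j : Set ι).indicator 1 := by
  obtain ⟨κ, _, w, z, hw0, hw1, hz, hpz⟩ :=
    mem_convexHull_iff_exists_fintype.1 (cappedSimplex_subset_convexHull hp)
  choose S hS hSz using hz
  exact ⟨κ, _, w, S, hw0, hw1, hS, by simpa only [← hSz] using hpz.symm⟩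

theorem isMaxOn_cappedSimplex_of_slackness {f p : ι → ℝ} {t : ℝ} (ht : 0 ≤ t) (hf : ∀ i, t ≤ f i)
    (hp : ∀ i, f i ≠ t → p i = 1) (hpk : t * ∑ i, p i = t * k) :
    IsMaxOn (fun q => ∑ i, f i * q i) (cappedSimplex ι k) p := by
  rintro q ⟨-, hq1, hqk⟩
  have hsplit : ∀ q : ι → ℝ, ∑ i, f i * q i = ∑ i, (f i - t) * q i + t * ∑ i, q i := fun q => by
    rw [mul_sum, ← sum_add_distrib]
    exact sum_congr rfl fun i _ => by ring
  have hexcess : ∀ i, (f i - t) * p i = f i - t := fun i => by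
    rcases eq_or_ne (f i) t with h | h
    · simp [h]
    · rw [hp i h, mul_one]
  calc ∑ i, f i * q i = ∑ i, (f i - t) * q i + t * ∑ i, q i := hsplit q
    _ ≤ ∑ i, (f i - t) * p i + t * ∑ i, p i := by
      rw [hpk, sum_congr rfl fun i _ => hexcess i]
      gcongr with i
      exact mul_le_of_le_one_right (sub_nonneg.2 (hf i)) (hq1 i)
    _ = ∑ i, f i * p i := (hsplit p).symm

end CappedSimplex

section Decomposition

variable {𝕜 E ι : Type*} [RCLike 𝕜] [NormedAddCommGroup E] [InnerProductSpace 𝕜 E] [Fintype ι]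

/-- The costs `∑ i, ‖c i‖` of the finite decompositions `X = ∑ i, c i • |v i⟩⟨w i|` into unit
vectors of `K`; their infimum is the `γ`-norm of `X` relative to `K`. -/
def decompositionCosts (𝕜 : Type*) {E : Type*} [RCLike 𝕜] [NormedAddCommGroup E]
    [InnerProductSpace 𝕜 E] (K : Set E) (X : E →L[𝕜] E) : Set ℝ :=
  {s | ∃ (N : ℕ) (c : Fin N → 𝕜) (v w : Fin N → E),
    (∀ i, ‖v i‖ = 1 ∧ v i ∈ K) ∧ (∀ i, ‖w i‖ = 1 ∧ w i ∈ K) ∧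
    X = ∑ i, c i • InnerProductSpace.rankOne 𝕜 (v i) (w i) ∧ s = ∑ i, ‖c i‖}

theorem nonneg_of_mem_decompositionCosts {K : Set E} {X : E →L[𝕜] E} {s : ℝ}
    (hs : s ∈ decompositionCosts 𝕜 K X) : 0 ≤ s := by
  obtain ⟨N, c, -, -, -, -, -, rfl⟩ := hs
  positivity

theorem rankOne_eq_smul_normalized {x y : E} (hx : x ≠ 0) (hy : y ≠ 0) :
    InnerProductSpace.rankOne 𝕜 x y = (‖x‖ * ‖y‖ : 𝕜) •
      InnerProductSpace.rankOne 𝕜 ((‖x‖⁻¹ : 𝕜) • x) ((‖y‖⁻¹ : 𝕜) • y) := by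
  have hx' : (‖x‖ : 𝕜) ≠ 0 := by simpa
  have hy' : (‖y‖ : 𝕜) ≠ 0 := by simpa
  ext z
  simp only [InnerProductSpace.rankOne_apply, _root_.smul_apply, inner_smul_left, smul_smul,
    map_inv₀, RCLike.conj_ofReal]
  field_simp

theorem sum_norm_mul_norm_mem_decompositionCosts {K : Set E} (hK : ∀ (c : 𝕜), ∀ x ∈ K, c • x ∈ K)
    {x y : ι → E} (hx : ∀ i, x i ∈ K) (hy : ∀ i, y i ∈ K) :
    ∑ i, ‖x i‖ * ‖y i‖ ∈
      decompositionCosts 𝕜 K (∑ i, InnerProductSpace.rankOne 𝕜 (x i) (y i)) := by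
  classical
  let t : Finset ι := {i | ‖x i‖ * ‖y i‖ ≠ 0}
  let e : Fin #t ≃ t := t.equivFin.symm
  have ht : ∀ j, x (e j) ≠ 0 ∧ y (e j) ≠ 0 := fun j => by
    simpa [t, not_or] using (e j).2
  refine ⟨#t, fun j => ‖x (e j)‖ * ‖y (e j)‖, fun j => (‖x (e j)‖⁻¹ : 𝕜) • x (e j),
    fun j => (‖y (e j)‖⁻¹ : 𝕜) • y (e j),
    fun j => ⟨norm_smul_inv_norm (ht j).1, hK _ _ (hx _)⟩,
    fun j => ⟨norm_smul_inv_norm (ht j).2, hK _ _ (hy _)⟩, ?_, ?_⟩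
  · have hzero : ∀ i ∈ univ, InnerProductSpace.rankOne 𝕜 (x i) (y i) ≠ 0 →
        ‖x i‖ * ‖y i‖ ≠ 0 := fun i _ h => by
      rwa [← InnerProductSpace.norm_rankOne (𝕜 := 𝕜), norm_ne_zero_iff]
    rw [← sum_filter_of_ne hzero, ← sum_coe_sort, ← e.sum_comp]
    exact sum_congr rfl fun j _ => rankOne_eq_smul_normalized (ht j).1 (ht j).2
  · rw [← sum_filter_ne_zero, ← sum_coe_sort, ← e.sum_comp]
    simp

theorem rankOne_sum_sum (x y : ι → E) :
    InnerProductSpace.rankOne 𝕜 (∑ i, x i) (∑ j, y j) =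
      ∑ q : ι × ι, InnerProductSpace.rankOne 𝕜 (x q.1) (y q.2) := by
  simp only [map_sum, _root_.sum_apply, Fintype.sum_prod_type]
  exact sum_comm

theorem exists_mem_decompositionCosts_le_sq {K : Set E} (hK : ∀ (c : 𝕜), ∀ x ∈ K, c • x ∈ K)
    {p : ι → ℝ} (hp0 : ∀ i, 0 ≤ p i) (hp1 : ∑ i, p i = 1) {x : ι → E} (hx : ∀ i, x i ∈ K) {R : ℝ}
    (hR : ∀ i, ‖x i‖ ≤ R) :
    ∃ s ∈ decompositionCosts 𝕜 K
      (InnerProductSpace.rankOne 𝕜 (∑ i, (p i : 𝕜) • x i) (∑ i, (p i : 𝕜) • x i)), s ≤ R ^ 2 := by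
  have hsum : ∑ i, ‖(p i : 𝕜) • x i‖ ≤ R := by
    calc ∑ i, ‖(p i : 𝕜) • x i‖ = ∑ i, p i * ‖x i‖ := by
          simp [norm_smul, abs_of_nonneg (hp0 _)]
      _ ≤ ∑ i, p i * R := sum_le_sum fun i _ => mul_le_mul_of_nonneg_left (hR i) (hp0 i)
      _ = R := by rw [← sum_mul, hp1, one_mul]
  refine ⟨∑ q : ι × ι, ‖(p q.1 : 𝕜) • x q.1‖ * ‖(p q.2 : 𝕜) • x q.2‖, ?_, ?_⟩
  · rw [rankOne_sum_sum]
    exact sum_norm_mul_norm_mem_decompositionCosts hK (fun q => hK _ _ (hx q.1))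
      fun q => hK _ _ (hx q.2)
  · calc ∑ q : ι × ι, ‖(p q.1 : 𝕜) • x q.1‖ * ‖(p q.2 : 𝕜) • x q.2‖
        = (∑ i, ‖(p i : 𝕜) • x i‖) ^ 2 := by
          simp only [sq, Fintype.sum_mul_sum, Fintype.sum_prod_type]
      _ ≤ R ^ 2 := by gcongr

theorem norm_inner_apply_le_of_mem_decompositionCosts {K : Set E} {X : E →L[𝕜] E} {s M : ℝ}
    (hs : s ∈ decompositionCosts 𝕜 K X) {w : E}
    (hw : ∀ u ∈ K, ‖u‖ = 1 → ‖inner 𝕜 w u‖ ^ 2 ≤ M) : ‖inner 𝕜 w (X w)‖ ≤ s * M := by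
  obtain ⟨N, c, x, y, hx, hy, rfl, rfl⟩ := hs
  have hterm : ∀ i, ‖inner 𝕜 w (x i)‖ * ‖inner 𝕜 (y i) w‖ ≤ M := fun i => by
    have hxi := hw _ (hx i).2 (hx i).1
    have hyi := hw _ (hy i).2 (hy i).1
    rw [norm_inner_symm (y i)]
    nlinarith [sq_nonneg (‖inner 𝕜 w (x i)‖ - ‖inner 𝕜 w (y i)‖)]
  calc ‖inner 𝕜 w ((∑ i, c i • InnerProductSpace.rankOne 𝕜 (x i) (y i)) w)‖
      = ‖∑ i, c i * (inner 𝕜 w (x i) * inner 𝕜 (y i) w)‖ := by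
        simp [inner_sum, inner_smul_right, mul_comm]
    _ ≤ ∑ i, ‖c i‖ * (‖inner 𝕜 w (x i)‖ * ‖inner 𝕜 (y i) w‖) := by
        simpa only [norm_mul] using
          norm_sum_le univ fun i => c i * (inner 𝕜 w (x i) * inner 𝕜 (y i) w)
    _ ≤ (∑ i, ‖c i‖) * M := by
        rw [sum_mul]
        gcongr with i
        exact hterm i

theorem sInf_decompositionCosts_rankOne_self {K : Set E} (hK : ∀ (c : 𝕜), ∀ x ∈ K, c • x ∈ K)
    {p : ι → ℝ} (hp0 : ∀ i, 0 ≤ p i) (hp1 : ∑ i, p i = 1) {x : ι → E} (hx : ∀ i, x i ∈ K) {M : ℝ}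
    (hxM : ∀ i, ‖x i‖ ^ 2 ≤ M) {v w : E} (hv : v = ∑ i, (p i : 𝕜) • x i)
    (hw : ∀ u ∈ K, ‖u‖ = 1 → ‖inner 𝕜 w u‖ ^ 2 ≤ M) (hwv : inner 𝕜 w v = (M : 𝕜)) :
    sInf (decompositionCosts 𝕜 K (InnerProductSpace.rankOne 𝕜 v v)) = M := by
  have hM : 0 ≤ M := by
    obtain ⟨i, -, -⟩ := exists_ne_zero_of_sum_ne_zero (hp1.trans_ne one_ne_zero)
    exact (sq_nonneg _).trans (hxM i)
  obtain ⟨s, hs, hsM⟩ :=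
    exists_mem_decompositionCosts_le_sq hK hp0 hp1 hx fun i => Real.le_sqrt_of_sq_le (hxM i)
  rw [← hv] at hs
  rw [Real.sq_sqrt hM] at hsM
  refine le_antisymm ((csInf_le ⟨0, fun _ => nonneg_of_mem_decompositionCosts⟩ hs).trans hsM)
    (le_csInf ⟨s, hs⟩ fun s' hs' => ?_)
  have hle : M * M ≤ s' * M := by
    simpa [inner_smul_right, hwv, norm_inner_symm v w, abs_of_nonneg hM] using
      norm_inner_apply_le_of_mem_decompositionCosts hs' hw
  rcases hM.eq_or_lt with hM0 | hM0
  · exact hM0 ▸ nonneg_of_mem_decompositionCosts hs'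
  · exact le_of_mul_le_mul_right hle hM0

end Decomposition

section InnerProductSpace

variable {𝕜 E F ι : Type*} [RCLike 𝕜] [NormedAddCommGroup E] [InnerProductSpace 𝕜 E]
  [NormedAddCommGroup F] [InnerProductSpace 𝕜 F] [Fintype ι]

theorem inner_sum_tmul_sum_tmul {b : ι → F} (hb : Orthonormal 𝕜 b) (x y : ι → E) :
    inner 𝕜 (∑ i, x i ⊗ₜ[𝕜] b i) (∑ i, y i ⊗ₜ[𝕜] b i) = ∑ i, inner 𝕜 (x i) (y i) := by
  classical
  simp [sum_inner, inner_sum, orthonormal_iff_ite.1 hb]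

theorem norm_sum_tmul_sq {b : ι → F} (hb : Orthonormal 𝕜 b) (x : ι → E) :
    ‖∑ i, x i ⊗ₜ[𝕜] b i‖ ^ 2 = ∑ i, ‖x i‖ ^ 2 := by
  simp only [norm_sq_eq_re_inner (𝕜 := 𝕜), inner_sum_tmul_sum_tmul hb, map_sum]

theorem sum_sq_norm_starProjection_le {a : ι → E} (ha : Orthonormal 𝕜 a)
    (V : Submodule 𝕜 E) [FiniteDimensional 𝕜 V] :
    ∑ i, ‖V.starProjection (a i)‖ ^ 2 ≤ Module.finrank 𝕜 V := by
  let e := stdOrthonormalBasis 𝕜 V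
  have hproj : ∀ i, ‖V.starProjection (a i)‖ ^ 2 = ∑ l, ‖inner 𝕜 (a i) (e l : E)‖ ^ 2 := fun i => by
    have h := e.sum_sq_norm_inner_left (V.orthogonalProjectionOnto (a i))
    simpa only [Submodule.coe_inner, ← Submodule.starProjection_apply,
      Submodule.inner_starProjection_left_eq_right,
      Submodule.starProjection_eq_self_iff.2 (e _).2, Submodule.coe_norm] using h.symm
  calc ∑ i, ‖V.starProjection (a i)‖ ^ 2 = ∑ l, ∑ i, ‖inner 𝕜 (a i) (e l : E)‖ ^ 2 := by
        simp only [hproj]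
        exact sum_comm
    _ ≤ ∑ l, ‖(e l : E)‖ ^ 2 := sum_le_sum fun l _ => ha.sum_inner_products_le _
    _ = Module.finrank 𝕜 V := by simp [← Submodule.coe_norm, e.norm_eq_one]

end InnerProductSpace

section SchmidtRank

variable {m n : ℕ}

theorem exists_eq_sum_tmul (u : Bipartite m n) :
    ∃ (x : Fin (schmidtRank u) → EuclideanSpace ℂ (Fin m))
      (y : Fin (schmidtRank u) → EuclideanSpace ℂ (Fin n)), u = ∑ j, x j ⊗ₜ[ℂ] y j := by
  obtain ⟨c, z, hz, hu⟩ := schmidtRank_spec u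
  choose x y _ _ hxy using hz
  refine ⟨fun j => c j • x j, y, ?_⟩
  simpa only [hxy, TensorProduct.smul_tmul'] using hu

theorem exists_isSeparable_tmul_eq_smul {x : EuclideanSpace ℂ (Fin m)}
    {y : EuclideanSpace ℂ (Fin n)} (h : x ⊗ₜ[ℂ] y ≠ 0) :
    ∃ (c : ℂ) (z : Bipartite m n), IsSeparable z ∧ x ⊗ₜ[ℂ] y = c • z := by
  have hx : x ≠ 0 := by rintro rfl; simp at h
  have hy : y ≠ 0 := by rintro rfl; simp at h
  refine ⟨‖x‖ * ‖y‖, _, ⟨(‖x‖⁻¹ : ℂ) • x, (‖y‖⁻¹ : ℂ) • y, norm_smul_inv_norm hx,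
    norm_smul_inv_norm hy, rfl⟩, ?_⟩
  rw [TensorProduct.smul_tmul_smul, smul_smul, mul_mul_mul_comm, mul_inv_cancel₀ (by simpa),
    mul_inv_cancel₀ (by simpa), one_mul, one_smul]

theorem schmidtRank_sum_tmul_le {ι : Type*} (s : Finset ι) (x : ι → EuclideanSpace ℂ (Fin m))
    (y : ι → EuclideanSpace ℂ (Fin n)) : schmidtRank (∑ i ∈ s, x i ⊗ₜ[ℂ] y i) ≤ #s := by
  classical
  let t := {i ∈ s | x i ⊗ₜ[ℂ] y i ≠ 0}
  choose c z hz hxyz using fun j : Fin #t =>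
    exists_isSeparable_tmul_eq_smul (mem_filter.1 (t.equivFin.symm j).2).2
  have hsum : ∑ i ∈ s, x i ⊗ₜ[ℂ] y i = ∑ j, c j • z j := by
    rw [← sum_filter_ne_zero, ← sum_coe_sort, ← t.equivFin.symm.sum_comp]
    exact sum_congr rfl fun j _ => hxyz j
  calc schmidtRank (∑ i ∈ s, x i ⊗ₜ[ℂ] y i) ≤ #t := Nat.sInf_le ⟨c, z, hz, hsum⟩
    _ ≤ #s := card_le_card (filter_subset _ s)

theorem schmidtRank_smul_le (z : ℂ) (u : Bipartite m n) :
    schmidtRank (z • u) ≤ schmidtRank u := by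
  obtain ⟨x, y, hu⟩ := exists_eq_sum_tmul u
  calc schmidtRank (z • u) = schmidtRank (∑ j, (z • x j) ⊗ₜ[ℂ] y j) := by
        conv_lhs => rw [hu, smul_sum]
        simp only [TensorProduct.smul_tmul']
    _ ≤ schmidtRank u := by simpa using schmidtRank_sum_tmul_le univ (fun j => z • x j) y

end SchmidtRank

section SchmidtVector

variable {m n k : ℕ} {ι : Type*} [Fintype ι] {a : ι → EuclideanSpace ℂ (Fin m)}
  {b : ι → EuclideanSpace ℂ (Fin n)}

/-- The vector `∑ i, c i • a i ⊗ b i`. The coefficients `c` are real but of arbitrary sign, and the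
families `a` and `b` are arbitrary; when both are orthonormal and `0 ≤ c`, this is a Schmidt
decomposition. -/
noncomputable def schmidtVector (a : ι → EuclideanSpace ℂ (Fin m))
    (b : ι → EuclideanSpace ℂ (Fin n)) (c : ι → ℝ) : Bipartite m n :=
  ∑ i, (c i : ℂ) • (a i ⊗ₜ[ℂ] b i)

theorem schmidtVector_eq_sum_tmul (c : ι → ℝ) :
    schmidtVector a b c = ∑ i, (c i • a i) ⊗ₜ[ℂ] b i := by
  simp only [schmidtVector, TensorProduct.smul_tmul', Complex.coe_smul]

theorem schmidtVector_sum_smul {κ : Type*} [Fintype κ] (p : κ → ℝ) (c : κ → ι → ℝ) :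
    schmidtVector a b (∑ j, p j • c j) = ∑ j, (p j : ℂ) • schmidtVector a b (c j) := by
  simp only [schmidtVector, Finset.sum_apply, Pi.smul_apply, smul_eq_mul, Complex.ofReal_sum,
    Complex.ofReal_mul, sum_smul, smul_sum, mul_smul]
  exact sum_comm

theorem schmidtRank_schmidtVector_indicator_le (S : Finset ι) (c : ι → ℝ) :
    schmidtRank (schmidtVector a b ((S : Set ι).indicator c)) ≤ #S := by
  classical
  have h : schmidtVector a b ((S : Set ι).indicator c) =
      ∑ i ∈ S, (c i • a i) ⊗ₜ[ℂ] b i := by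
    rw [schmidtVector_eq_sum_tmul]
    exact (sum_subset_zero_on_sdiff S.subset_univ (by simp +contextual) (by simp +contextual)).symm
  exact h ▸ schmidtRank_sum_tmul_le S _ _

theorem inner_schmidtVector (ha : ∀ i, ‖a i‖ = 1) (hb : Orthonormal ℂ b) (c d : ι → ℝ) :
    ⟪schmidtVector a b c, schmidtVector a b d⟫_ℂ = ↑(∑ i, c i * d i) := by
  rw [schmidtVector_eq_sum_tmul, schmidtVector_eq_sum_tmul, inner_sum_tmul_sum_tmul hb]
  simp [inner_smul_left_eq_smul, inner_smul_right_eq_smul, ha, mul_comm]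

theorem norm_schmidtVector_sq (ha : ∀ i, ‖a i‖ = 1) (hb : Orthonormal ℂ b) (c : ι → ℝ) :
    ‖schmidtVector a b c‖ ^ 2 = ∑ i, c i ^ 2 := by
  simp [schmidtVector_eq_sum_tmul, norm_sum_tmul_sq hb, norm_smul, ha]

theorem inner_schmidtVector_sum_tmul {κ : Type*} [Fintype κ]
    (V : Submodule ℂ (EuclideanSpace ℂ (Fin m))) (c : ι → ℝ)
    {x : κ → EuclideanSpace ℂ (Fin m)} (hx : ∀ j, x j ∈ V) (y : κ → EuclideanSpace ℂ (Fin n)) :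
    ⟪schmidtVector a b c, ∑ j, x j ⊗ₜ y j⟫_ℂ =
      ⟪schmidtVector (fun i => V.starProjection (a i)) b c, ∑ j, x j ⊗ₜ y j⟫_ℂ := by
  simp [schmidtVector_eq_sum_tmul, sum_inner, inner_sum, inner_smul_left_eq_smul,
    V.inner_starProjection_left_eq_right, V.starProjection_eq_self_iff.2 (hx _)]

theorem exists_mem_cappedSimplex_norm_inner_sq_le (ha : Orthonormal ℂ a) (hb : Orthonormal ℂ b)
    (c : ι → ℝ) (u : Bipartite m n) :
    ∃ q ∈ cappedSimplex ι (schmidtRank u),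
      ‖⟪schmidtVector a b c, u⟫_ℂ‖ ^ 2 ≤ (∑ i, c i ^ 2 * q i) * ‖u‖ ^ 2 := by
  obtain ⟨x, y, hu⟩ := exists_eq_sum_tmul u
  let V := Submodule.span ℂ (Set.range x)
  let w := schmidtVector (fun i => V.starProjection (a i)) b c
  have hV : Module.finrank ℂ V ≤ schmidtRank u :=
    (finrank_range_le_card x).trans_eq (Fintype.card_fin _)
  have hwu : ⟪schmidtVector a b c, u⟫_ℂ = ⟪w, u⟫_ℂ := by
    rw [hu]
    exact inner_schmidtVector_sum_tmul V c (fun j => Submodule.subset_span ⟨j, rfl⟩) y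
  have hw : ‖w‖ ^ 2 = ∑ i, c i ^ 2 * ‖V.starProjection (a i)‖ ^ 2 := by
    simp [w, schmidtVector_eq_sum_tmul, norm_sum_tmul_sq hb, norm_smul, mul_pow]
  refine ⟨fun i => ‖V.starProjection (a i)‖ ^ 2, ⟨fun i => by positivity, fun i => ?_, ?_⟩, ?_⟩
  · exact pow_le_one₀ (norm_nonneg _) ((V.norm_starProjection_apply_le _).trans_eq (ha.1 i))
  · exact (sum_sq_norm_starProjection_le ha V).trans (mod_cast hV)
  · rw [hwu, ← hw, ← mul_pow]
    gcongr
    exact norm_inner_le_norm w u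

end SchmidtVector

section GammaNorm

variable {m n k : ℕ} {ι : Type*} [Fintype ι] {a : ι → EuclideanSpace ℂ (Fin m)}
  {b : ι → EuclideanSpace ℂ (Fin n)}

theorem norm_inner_schmidtVector_sq_le (ha : Orthonormal ℂ a) (hb : Orthonormal ℂ b) {c : ι → ℝ}
    {p : ι → ℝ} (hmax : IsMaxOn (fun q => ∑ i, c i ^ 2 * q i) (cappedSimplex ι k) p)
    {u : Bipartite m n} (hu : schmidtRank u ≤ k) (hu1 : ‖u‖ = 1) :
    ‖⟪schmidtVector a b c, u⟫_ℂ‖ ^ 2 ≤ ∑ i, c i ^ 2 * p i := by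
  obtain ⟨q, hq, hle⟩ := exists_mem_cappedSimplex_norm_inner_sq_le ha hb c u
  rw [hu1, one_pow, mul_one] at hle
  exact hle.trans (hmax (cappedSimplex_mono hu hq))

theorem gammaNorm_ketbra_schmidtVector_mul (ha : Orthonormal ℂ a) (hb : Orthonormal ℂ b)
    {c p : ι → ℝ} (hp : p ∈ cappedSimplex ι k)
    (hmax : IsMaxOn (fun q => ∑ i, c i ^ 2 * q i) (cappedSimplex ι k) p) :
    gammaNorm k (ketbra (schmidtVector a b (c * p)) (schmidtVector a b (c * p))) =
      ∑ i, c i ^ 2 * p i := by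
  obtain ⟨κ, _, w, S, hw0, hw1, hS, hpS⟩ := exists_sum_smul_indicator_eq_of_mem_cappedSimplex hp
  have hv : schmidtVector a b (c * p) =
      ∑ j, (w j : ℂ) • schmidtVector a b ((S j : Set ι).indicator c) := by
    rw [← schmidtVector_sum_smul, hpS, mul_sum]
    congr! 2 with j
    ext i
    by_cases hi : i ∈ (S j : Set ι) <;> simp [hi, mul_comm]
  have hnorm : ∀ j, ‖schmidtVector a b ((S j : Set ι).indicator c)‖ ^ 2 ≤ ∑ i, c i ^ 2 * p i :=
    fun j => by
      classical
      refine Eq.trans_le ?_ (hmax (indicator_one_mem_cappedSimplex (hS j)))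
      simp [norm_schmidtVector_sq ha.1 hb, Set.indicator_apply]
  refine sInf_decompositionCosts_rankOne_self
    (fun z u hu => (schmidtRank_smul_le z u).trans hu) hw0 hw1
    (fun j => (schmidtRank_schmidtVector_indicator_le (S j) c).trans (hS j)) hnorm hv
    (fun u hu hu1 => norm_inner_schmidtVector_sq_le ha hb hmax hu hu1) ?_
  rw [inner_schmidtVector ha.1 hb]
  simp [sq, mul_assoc]

end GammaNorm

section WaterFilling

variable {k : ℕ} {ι : Type*} [DecidableEq ι] {α : ι → ℝ} {H : Finset ι} {t : ℝ}

theorem piecewise_mul_piecewise_one_div (hα : ∀ i, 0 ≤ α i) (hHc : ∀ i ∉ H, α i ≤ t) :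
    H.piecewise α (fun _ => t) * H.piecewise (1 : ι → ℝ) (fun i => α i / t) = α := by
  ext i
  by_cases hi : i ∈ H
  · simp [hi]
  · simpa [hi] using mul_div_cancel_of_imp' fun h0 => le_antisymm (h0 ▸ hHc i hi) (hα i)

variable [Fintype ι]

theorem sum_piecewise_one_div (ht : ∑ i ∈ Hᶜ, α i = (k - #H) * t) :
    ∑ i, H.piecewise (1 : ι → ℝ) (fun i => α i / t) i = #H + (k - #H) * (t / t) := by
  simp [sum_piecewise, ← compl_eq_univ_sdiff, ← sum_div, ht, mul_div_assoc]

theorem piecewise_one_div_mem_cappedSimplex (hα : ∀ i, 0 ≤ α i) (hHk : #H ≤ k) (ht0 : 0 ≤ t)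
    (hHc : ∀ i ∉ H, α i ≤ t) (ht : ∑ i ∈ Hᶜ, α i = (k - #H) * t) :
    H.piecewise (1 : ι → ℝ) (fun i => α i / t) ∈ cappedSimplex ι k := by
  refine ⟨fun i => ?_, fun i => ?_, ?_⟩
  · by_cases hi : i ∈ H <;> simp [hi, div_nonneg (hα i) ht0]
  · by_cases hi : i ∈ H <;> simp [hi, div_le_one_of_le₀ (hHc i _) ht0]
  · have hHk' : (0 : ℝ) ≤ k - #H := sub_nonneg.2 (mod_cast hHk)
    rw [sum_piecewise_one_div ht]
    linarith [mul_le_of_le_one_right hHk' (div_self_le_one t)]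

theorem isMaxOn_cappedSimplex_piecewise_one_div (ht0 : 0 ≤ t) (hH : ∀ i ∈ H, t ≤ α i)
    (ht : ∑ i ∈ Hᶜ, α i = (k - #H) * t) :
    IsMaxOn (fun q => ∑ i, H.piecewise α (fun _ => t) i ^ 2 * q i) (cappedSimplex ι k)
      (H.piecewise (1 : ι → ℝ) fun i => α i / t) := by
  refine isMaxOn_cappedSimplex_of_slackness (sq_nonneg t) (fun i => ?_) (fun i hi => ?_) ?_
  · by_cases hi : i ∈ H
    · simpa [hi] using pow_le_pow_left₀ ht0 (hH i hi) 2
    · simp [hi]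
  · by_cases hiH : i ∈ H
    · simp [hiH]
    · simp [hiH] at hi
  · rw [sum_piecewise_one_div ht]
    rcases eq_or_ne t 0 with rfl | h0
    · simp
    · rw [div_self h0]
      ring

theorem gammaNorm_ketbra_schmidtVector_of_waterFilling {m n : ℕ}
    {a : ι → EuclideanSpace ℂ (Fin m)} {b : ι → EuclideanSpace ℂ (Fin n)} (ha : Orthonormal ℂ a)
    (hb : Orthonormal ℂ b) (hα : ∀ i, 0 ≤ α i) (hHk : #H ≤ k) (ht0 : 0 ≤ t)
    (hH : ∀ i ∈ H, t ≤ α i) (hHc : ∀ i ∉ H, α i ≤ t) (ht : ∑ i ∈ Hᶜ, α i = (k - #H) * t) :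
    gammaNorm k (ketbra (schmidtVector a b α) (schmidtVector a b α)) =
      ∑ i ∈ H, α i ^ 2 + (k - #H) * t ^ 2 := by
  let β : ι → ℝ := H.piecewise α fun _ => t
  let p : ι → ℝ := H.piecewise 1 fun i => α i / t
  have hβp : β * p = α := piecewise_mul_piecewise_one_div hα hHc
  have hnorm := gammaNorm_ketbra_schmidtVector_mul ha hb
    (piecewise_one_div_mem_cappedSimplex hα hHk ht0 hHc ht)
    (isMaxOn_cappedSimplex_piecewise_one_div ht0 hH ht)
  calc gammaNorm k (ketbra (schmidtVector a b α) (schmidtVector a b α))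
      = ∑ i, β i ^ 2 * p i := hβp ▸ hnorm
    _ = ∑ i, H.piecewise (fun i => α i ^ 2) (fun i => t * α i) i := by
      refine sum_congr rfl fun i _ => ?_
      rw [sq, mul_assoc, show β i * p i = α i from congrFun hβp i]
      by_cases hi : i ∈ H <;> simp [β, hi, sq]
    _ = ∑ i ∈ H, α i ^ 2 + (k - #H) * t ^ 2 := by
      rw [sum_piecewise, univ_inter, ← compl_eq_univ_sdiff, ← mul_sum, ht]
      ring

end WaterFilling

section CutIndex

variable {d k : ℕ} {α : ℕ → ℝ}

theorem sub_mul_tailMean {r : ℕ} (hr : r < k) :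
    ((k : ℝ) - r) * tailMean d k α r = ∑ i ∈ Icc (r + 1) d, α i :=
  mul_div_cancel₀ _ (sub_ne_zero.2 (mod_cast hr.ne'))

theorem bddAbove_tailMean_lt :
    BddAbove {r : ℕ | 1 ≤ r ∧ r < k ∧ tailMean d k α r < α r} :=
  ⟨k, fun _ hr => hr.2.1.le⟩

theorem cutIndex_lt_and_tailMean_lt (h : cutIndex d k α ≠ 0) :
    cutIndex d k α < k ∧ tailMean d k α (cutIndex d k α) < α (cutIndex d k α) := by
  have hne : {r : ℕ | 1 ≤ r ∧ r < k ∧ tailMean d k α r < α r}.Nonempty := by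
    by_contra! hempty
    exact h (by rw [cutIndex, hempty, csSup_empty, bot_eq_zero])
  exact (Nat.sSup_mem hne bddAbove_tailMean_lt).2

theorem cutIndex_lt (hk : 1 ≤ k) (α : ℕ → ℝ) : cutIndex d k α < k := by
  by_cases h : cutIndex d k α = 0
  · rwa [h]
  · exact (cutIndex_lt_and_tailMean_lt h).1

theorem le_tailMean_of_cutIndex_lt {r : ℕ} (hr : cutIndex d k α < r) (hrk : r < k) :
    α r ≤ tailMean d k α r := by
  by_contra! h
  exact hr.not_ge (le_csSup bddAbove_tailMean_lt ⟨by lia, hrk, h⟩)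

theorem le_tailMean_of_sub_mul_le {r : ℕ} (hrk : r < k) (hrd : r < d)
    (hnext : ((k : ℝ) - (r + 1 : ℕ)) * α (r + 1) ≤ ∑ i ∈ Icc (r + 1 + 1) d, α i) :
    α (r + 1) ≤ tailMean d k α r := by
  have hkr : (0 : ℝ) < k - r := sub_pos.2 (mod_cast hrk)
  rw [tailMean, le_div_iff₀' hkr]
  calc ((k : ℝ) - r) * α (r + 1) = α (r + 1) + (k - (r + 1 : ℕ)) * α (r + 1) := by
        push_cast
        ring
    _ ≤ α (r + 1) + ∑ i ∈ Icc (r + 1 + 1) d, α i := by gcongr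
    _ = ∑ i ∈ Icc (r + 1) d, α i := by
      rw [Icc_add_one_left_eq_Ioc, add_sum_Ioc_eq_sum_Icc hrd]

theorem le_tailMean_cutIndex (hk : 1 ≤ k) (hkd : k ≤ d) (hα : ∀ i ∈ Set.Icc 1 d, 0 ≤ α i) :
    α (cutIndex d k α + 1) ≤ tailMean d k α (cutIndex d k α) := by
  have hlt : cutIndex d k α < k := cutIndex_lt hk α
  refine le_tailMean_of_sub_mul_le hlt (hlt.trans_le hkd) ?_
  rcases (Nat.succ_le_of_lt hlt).lt_or_eq with h | h
  · rw [← sub_mul_tailMean h]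
    gcongr
    · exact sub_nonneg.2 (mod_cast h.le)
    · exact le_tailMean_of_cutIndex_lt (Nat.lt_succ_self _) h
  · have hk_sub : (k : ℝ) - (cutIndex d k α + 1 : ℕ) = 0 := sub_eq_zero.2 (mod_cast h.symm)
    rw [hk_sub, zero_mul]
    exact sum_nonneg fun i hi => hα i ⟨by simp at hi; lia, (mem_Icc.1 hi).2⟩

end CutIndex

section FinIndex

variable {d : ℕ} (P : ℕ → Prop) [DecidablePred P] (f : ℕ → ℝ)

theorem sum_fin_filter_succ :
    ∑ i : Fin d with P (i.val + 1), f (i.val + 1) = ∑ i ∈ Icc 1 d with P i, f i := by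
  rw [sum_filter, sum_filter,
    Fin.sum_univ_eq_sum_range fun i => if P (i + 1) then f (i + 1) else 0, range_eq_Ico,
    sum_Ico_add' (fun i => if P i then f i else 0) 0 d 1]
  rfl

theorem sum_fin_filter_le {r : ℕ} (hr : r ≤ d) :
    ∑ i : Fin d with i.val + 1 ≤ r, f (i.val + 1) = ∑ i ∈ Icc 1 r, f i := by
  rw [sum_fin_filter_succ (· ≤ r)]
  congr 1
  ext i
  simp only [mem_filter, mem_Icc]
  lia

theorem sum_compl_fin_filter_le (r : ℕ) :
    ∑ i ∈ ({i : Fin d | i.val + 1 ≤ r} : Finset (Fin d))ᶜ, f (i.val + 1) =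
      ∑ i ∈ Icc (r + 1) d, f i := by
  rw [compl_filter, sum_fin_filter_succ (¬ · ≤ r)]
  congr 1
  ext i
  simp only [mem_filter, mem_Icc]
  lia

end FinIndex

end EntanglementNorm

open EntanglementNorm Finset in
theorem theorem5p1_general {m n k : ℕ} (hk : 1 ≤ k) (hkmn : k ≤ min m n) (v : Bipartite m n)
    (α : ℕ → ℝ) (hα : IsSchmidtCoefficients v α) (r : ℕ) (hr : r = cutIndex (min m n) k α)
    (αt : ℝ) (hαt : αt = tailMean (min m n) k α r) :
    gammaNorm k (ketbra v v) = ∑ i ∈ Icc 1 r, α i ^ 2 + ((k : ℝ) - r) * αt ^ 2 := by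
  obtain ⟨hanti, hα0, a, b, ha, hb, hv⟩ := hα
  have hrk : r < k := hr ▸ cutIndex_lt hk α
  have hrd : r < min m n := hrk.trans_le hkmn
  have hnext : α (r + 1) ≤ αt := by
    subst hr hαt
    exact le_tailMean_cutIndex hk hkmn hα0
  have hcut : r ≠ 0 → αt < α r := by
    subst hr hαt
    exact fun h => (cutIndex_lt_and_tailMean_lt h).2
  have hmem : ∀ i : Fin (min m n), i.val + 1 ∈ Set.Icc 1 (min m n) := fun i => ⟨by lia, i.2⟩
  let H : Finset (Fin (min m n)) := {i | i.val + 1 ≤ r}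
  have hH : #H = r := by simp [H, Fin.card_filter_val_lt, hrd.le]
  have hcost : gammaNorm k (ketbra v v) = ∑ i ∈ H, α (i.val + 1) ^ 2 + ((k : ℝ) - #H) * αt ^ 2 := by
    rw [hv]
    refine gammaNorm_ketbra_schmidtVector_of_waterFilling ha hb (fun i => hα0 _ (hmem i))
      (hH.trans_le hrk.le) ((hα0 _ ⟨by lia, hrd⟩).trans hnext) (fun i hi => ?_) (fun i hi => ?_) ?_
    · have hi : i.val + 1 ≤ r := (mem_filter.1 hi).2
      exact (hcut (by lia)).le.trans (hanti (hmem i) ⟨by lia, hrd.le⟩ hi)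
    · have hi : r + 1 ≤ i.val + 1 := by simpa [H] using hi
      exact (hanti ⟨by lia, hrd⟩ (hmem i) hi).trans hnext
    · rw [sum_compl_fin_filter_le, hH, hαt, sub_mul_tailMean hrk]
  rwa [sum_fin_filter_le (fun i => α i ^ 2) hrd.le, hH] at hcost

theorem theorem5p1 {m n k : ℕ} (hk : 1 ≤ k) (hkmn : k ≤ min m n)
    (v : EntanglementNorm.Bipartite m n) (hv : ‖v‖ = 1)
    (α : ℕ → ℝ) (hα : EntanglementNorm.IsSchmidtCoefficients v α)
    (r : ℕ) (hr : r = EntanglementNorm.cutIndex (min m n) k α)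
    (αt : ℝ) (hαt : αt = EntanglementNorm.tailMean (min m n) k α r) :
    EntanglementNorm.gammaNorm k (EntanglementNorm.ketbra v v) =
      ∑ i ∈ Finset.Icc 1 r, α i ^ 2 + ((k : ℝ) - (r : ℝ)) * αt ^ 2 :=
  theorem5p1_general hk hkmn v α hα r hr αt hαt
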